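/- **Theorem.** Let $(\Omega,\mathcal A,P)$ be a probability space, let $(T,\mathcal B,\nu)$ be a finite measure space, and let $X=(X_t)_{t\in T}$ be a centered real-valued Gaussian process over $(\Omega,\mathcal A,P)$. Let $H_X$ be the reproducing kernel Hilbert space (RKHS) on $T$ of the covariance function $k_X(s,t)=\mathbb E(X_sX_t)$, and assume that every function in $H_X$ is bounded and $\mathcal B$-measurable. Let $I_{X,\nu}:H_X\to L_2(\nu)$, $h\mapsto [h]_\sim$, be the embedding into $\nu$-equivalence classes (a bounded operator), and let $T_{X,\nu}:=I_{X,\nu}\circ I_{X,\nu}^*:L_2(\nu)\to L_2(\nu)$, which is the integral operator with kernel $k_X$. Let $(\mu_i)_{i\in I}$ be the non-zero eigenvalues of $T_{X,\nu}$, repeated according to geometric multiplicity (they are positive), and let $(e_i)_{i\in I}\subset H_X$ be a family such that $([e_i]_\sim)_{i\in I}$ is an orthonormal system in $L_2(\nu)$ and each $[e_i]_\sim$ is an eigenfunction of $T_{X,\nu}$ for the eigenvalue $\mu_i$. Then the following statements hold. (i) The operator $I_{X,\nu}$ is nuclear if and only if $\sum_{i\in I}\sqrt{\mu_i}<\infty$.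 (ii) Assume that $\nu$ is $H_X$-positive, i.e. $I_{X,\nu}$ is injective, and let $\beta\in(0,1)$ satisfy $\sum_{i\in I}\mu_i^{\beta}e_i(t)^2<\infty$ for all $t\in T$. Let $$H_X^\beta:=\Bigl\{\sum_{i\in I}a_i\mu_i^{\beta/2}e_i \;:\; (a_i)_{i\in I}\in\ell_2(I)\Bigr\}$$ (with pointwise convergence of the series) be the RKHS on $T$ for which $(\mu_i^{\beta/2}e_i)_{i\in I}$ is an orthonormal basis. For RKHSs $H_1,H_2$ on $T$ write $H_1\ll H_2$ if $H_1\subset H_2$ and the embedding map $H_1\to H_2$ is a Hilbert–Schmidt operator. Then $$H_X\ll H_X^\beta\quad\Longleftrightarrow\quad \sum_{i\in I}\mu_i^{1-\beta}<\infty .$$ In this case there exists a version $Y$ of $X$ (a process on the same probability space with $P(Y_t=X_t)=1$ for every $t\in T$) whose paths $t\mapsto Y_t(\omega)$ belong to $H_X^\beta$ for $P$-almost every $\omega$. -/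

import Mathlib

open MeasureTheory ProbabilityTheory Filter Topology
open scoped InnerProductSpace

noncomputable section

namespace GaussianPaths

universe u v w

/-! ### Nuclear and Hilbert-Schmidt operators -/

section Operators

/-- A bounded operator `S : E → F` is nuclear if `S x = ∑ₙ φₙ(x) yₙ` for some `φₙ ∈ E'`, `yₙ ∈ F`
with `∑ₙ ‖φₙ‖ ‖yₙ‖ < ∞`. -/
def IsNuclear {E F : Type*} [NormedAddCommGroup E] [NormedSpace ℝ E]
    [NormedAddCommGroup F] [NormedSpace ℝ F] (S : E →L[ℝ] F) : Prop :=
  ∃ (φ : ℕ → (E →L[ℝ] ℝ)) (y : ℕ → F),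
    Summable (fun n => ‖φ n‖ * ‖y n‖) ∧ ∀ x, HasSum (fun n => φ n x • y n) (S x)

/-- A bounded operator `S : E → F` between Hilbert spaces is Hilbert-Schmidt if
`∑_j ‖S b_j‖² < ∞` for some orthonormal basis `(b_j)` of `E`. The basis is indexed by
a set of vectors of `E`, which is no restriction. -/
def IsHilbertSchmidt {E F : Type*} [NormedAddCommGroup E] [InnerProductSpace ℝ E]
    [NormedAddCommGroup F] [InnerProductSpace ℝ F] (S : E →L[ℝ] F) : Prop :=
  ∃ (J : Set E) (b : HilbertBasis J ℝ E), Summable (fun j => ‖S (b j)‖ ^ 2)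

/-- Nuclear dominance `H₁ ≪ H₂` of RKHSs on `T`: as sets of functions `H₁ ⊆ H₂`, and the
embedding map is a Hilbert-Schmidt operator. -/
def NuclearlyDominated {T : Type u} (H₁ : Type v) (H₂ : Type w)
    [NormedAddCommGroup H₁] [InnerProductSpace ℝ H₁] [RKHS ℝ H₁ T ℝ]
    [NormedAddCommGroup H₂] [InnerProductSpace ℝ H₂] [RKHS ℝ H₂ T ℝ] : Prop :=
  ∃ J : H₁ →L[ℝ] H₂, (∀ h t, J h t = h t) ∧ IsHilbertSchmidt J

end Operators

/-! ### The RKHS of a centered Gaussian process -/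

section Covariance

variable {Ω T : Type*} [MeasurableSpace Ω]

/-- `X = (X_t)_{t ∈ T}` is a centered real Gaussian process on `(Ω, P)`. -/
structure IsCenteredGaussianProcess (X : T → Ω → ℝ) (P : Measure Ω) : Prop where
  measurable : ∀ t, Measurable (X t)
  gaussian : IsGaussianProcess X P
  centered : ∀ t, ∫ ω, X t ω ∂P = 0

/-- `Y` is a version of `X`: `Y` is a process on the same probability space with
`P(Y_t = X_t) = 1` for all `t`. -/
def IsVersion (Y X : T → Ω → ℝ) (P : Measure Ω) : Prop :=
  ∀ t, Measurable (Y t) ∧ ∀ᵐ ω ∂P, Y t ω = X t ω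

/-- The covariance function `k_X(s,t) = E (X_s X_t)`. -/
def covFun (X : T → Ω → ℝ) (P : Measure Ω) (s t : T) : ℝ := ∫ ω, X s ω * X t ω ∂P

/-- A scalar kernel as an operator-valued matrix, its entries acting on `ℝ` by multiplication. -/
def kernelMatrix (k : T → T → ℝ) : Matrix T T (ℝ →L[ℝ] ℝ) :=
  Matrix.of fun s t => k s t • ContinuousLinearMap.id ℝ ℝ

lemma posSemidef_kernelMatrix_covFun {X : T → Ω → ℝ} {P : Measure Ω}
    (hX : IsCenteredGaussianProcess X P) : (kernelMatrix (covFun X P)).PosSemidef := by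
  have hL : ∀ t, MemLp (X t) 2 P := fun t => (hX.gaussian.hasGaussianLaw_eval t).memLp_two
  have htfae := (RKHS.posSemidef_tfae (K := kernelMatrix (covFun X P))).out 0 2
  refine htfae.mpr ⟨?_, fun v => ?_⟩
  · ext s t
    simp only [kernelMatrix, covFun, Matrix.conjTranspose_apply, Matrix.of_apply]
    have hid : (ContinuousLinearMap.id ℝ ℝ).adjoint = ContinuousLinearMap.id ℝ ℝ :=
      ContinuousLinearMap.adjoint_id
    simp [mul_comm, ContinuousLinearMap.star_eq_adjoint, hid]
  · have hint : ∀ s t, Integrable (fun ω => (v s * X s ω) * (v t * X t ω)) P := fun s t => by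
      have := ((hL s).integrable_mul (hL t)).const_mul (v s * v t)
      refine this.congr (ae_of_all _ fun ω => ?_)
      simp only [Pi.mul_apply]; ring
    have key : (v.sum fun x w => v.sum fun x' w' =>
        ⟪kernelMatrix (covFun X P) x' x w, w'⟫_ℝ)
        = ∫ ω, (∑ s ∈ v.support, v s * X s ω) ^ 2 ∂P := by
      have h1 : ∀ ω, (∑ s ∈ v.support, v s * X s ω) ^ 2
          = ∑ s ∈ v.support, ∑ t ∈ v.support, (v s * X s ω) * (v t * X t ω) := fun ω => by
        rw [sq, Finset.sum_mul_sum]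
      simp_rw [h1]
      rw [integral_finsetSum _ fun s _ => integrable_finsetSum _ fun t _ => hint s t]
      refine Finset.sum_congr rfl fun s _ => ?_
      rw [integral_finsetSum _ fun t _ => hint s t]
      refine Finset.sum_congr rfl fun t _ => ?_
      have : ∀ ω, (v s * X s ω) * (v t * X t ω) = (v s * v t) * (X t ω * X s ω) :=
        fun ω => by ring
      simp_rw [this]
      rw [integral_const_mul]
      simp [kernelMatrix, covFun]
      ring
    rw [key]
    exact integral_nonneg fun ω => sq_nonneg _

/-- The RKHS `H_X` of the covariance function `k_X` of a centered Gaussian process `X`. -/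
def CovRKHS {X : T → Ω → ℝ} {P : Measure Ω} (hX : IsCenteredGaussianProcess X P) : Type _ :=
  haveI : Fact (kernelMatrix (covFun X P)).PosSemidef := ⟨posSemidef_kernelMatrix_covFun hX⟩
  RKHS.OfKernel (kernelMatrix (covFun X P))

section Instances

variable {X : T → Ω → ℝ} {P : Measure Ω} (hX : IsCenteredGaussianProcess X P)

instance : NormedAddCommGroup (CovRKHS hX) :=
  haveI : Fact (kernelMatrix (covFun X P)).PosSemidef := ⟨posSemidef_kernelMatrix_covFun hX⟩
  inferInstanceAs (NormedAddCommGroup (RKHS.OfKernel (kernelMatrix (covFun X P))))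

instance : InnerProductSpace ℝ (CovRKHS hX) :=
  haveI : Fact (kernelMatrix (covFun X P)).PosSemidef := ⟨posSemidef_kernelMatrix_covFun hX⟩
  inferInstanceAs (InnerProductSpace ℝ (RKHS.OfKernel (kernelMatrix (covFun X P))))

instance : CompleteSpace (CovRKHS hX) :=
  haveI : Fact (kernelMatrix (covFun X P)).PosSemidef := ⟨posSemidef_kernelMatrix_covFun hX⟩
  inferInstanceAs (CompleteSpace (RKHS.OfKernel (kernelMatrix (covFun X P))))

instance : RKHS ℝ (CovRKHS hX) T ℝ :=
  haveI : Fact (kernelMatrix (covFun X P)).PosSemidef := ⟨posSemidef_kernelMatrix_covFun hX⟩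
  inferInstanceAs (RKHS ℝ (RKHS.OfKernel (kernelMatrix (covFun X P))) T ℝ)

/-- The reproducing kernel of `H_X` is `k_X`. -/
lemma kernel_covRKHS : RKHS.kernel (CovRKHS hX) = kernelMatrix (covFun X P) :=
  haveI : Fact (kernelMatrix (covFun X P)).PosSemidef := ⟨posSemidef_kernelMatrix_covFun hX⟩
  RKHS.OfKernel.kernel_ofKernel (K := kernelMatrix (covFun X P))

end Instances

end Covariance

/-! ### The embedding into `L²(ν)` and the integral operator -/

section Embedding

variable {T : Type*} [MeasurableSpace T] {H : Type*} [NormedAddCommGroup H]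
  [InnerProductSpace ℝ H] [RKHS ℝ H T ℝ]

/-- The RKHS `H` consists of bounded measurable functions. -/
def BoundedMeasurable (H : Type*) [NormedAddCommGroup H] [InnerProductSpace ℝ H]
    [RKHS ℝ H T ℝ] : Prop :=
  ∀ h : H, Measurable (h : T → ℝ) ∧ ∃ C : ℝ, ∀ t, |h t| ≤ C

lemma BoundedMeasurable.memLp (hH : BoundedMeasurable (T := T) H) (ν : Measure T)
    [IsFiniteMeasure ν] (h : H) : MemLp (h : T → ℝ) 2 ν := by
  obtain ⟨hm, C, hC⟩ := hH h
  exact MemLp.of_bound hm.aestronglyMeasurable C (ae_of_all _ fun t => hC t)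

lemma BoundedMeasurable.exists_bound [CompleteSpace H] (hH : BoundedMeasurable (T := T) H) :
    ∃ C : ℝ, 0 ≤ C ∧ ∀ (h : H) t, |h t| ≤ C * ‖h‖ := by
  obtain ⟨C, hC⟩ := banach_steinhaus
    (g := fun t : T => (ContinuousLinearMap.proj t ∘L RKHS.coeCLM ℝ (H := H) : H →L[ℝ] ℝ))
    (fun h => by
      obtain ⟨-, C, hC⟩ := hH h
      exact ⟨C, fun t => by simpa using hC t⟩)
  refine ⟨max C 0, le_max_right _ _, fun h t => ?_⟩
  have h1 := (ContinuousLinearMap.proj t ∘L RKHS.coeCLM ℝ (H := H) : H →L[ℝ] ℝ).le_opNorm h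
  exact h1.trans (mul_le_mul_of_nonneg_right ((hC t).trans (le_max_left _ _)) (norm_nonneg _))

variable [CompleteSpace H]

/-- The embedding operator `I_ν : H → L²(ν)`, `h ↦ [h]`. -/
def toL2 (hH : BoundedMeasurable (T := T) H) (ν : Measure T) [IsFiniteMeasure ν] :
    H →L[ℝ] Lp ℝ 2 ν :=
  LinearMap.mkContinuousOfExistsBound
    { toFun := fun h => (hH.memLp ν h).toLp h
      map_add' := fun f g => by
        rw [← MemLp.toLp_add]; congr 1; simp
      map_smul' := fun c f => by
        rw [RingHom.id_apply, ← MemLp.toLp_const_smul]; congr 1; simp }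
    (by
      obtain ⟨C, hC0, hC⟩ := hH.exists_bound
      refine ⟨(measureUnivNNReal ν : ℝ) ^ (2 : ENNReal).toReal⁻¹ * C, fun h => ?_⟩
      rw [mul_assoc]
      refine Lp.norm_le_of_ae_bound (mul_nonneg hC0 (norm_nonneg h)) ?_
      filter_upwards [(hH.memLp ν h).coeFn_toLp] with t ht
      change ‖(hH.memLp ν h).toLp h t‖ ≤ _
      rw [ht]
      exact hC h t)

lemma coeFn_toL2 (hH : BoundedMeasurable (T := T) H) (ν : Measure T) [IsFiniteMeasure ν]
    (h : H) : (toL2 hH ν h : T → ℝ) =ᵐ[ν] h :=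
  (hH.memLp ν h).coeFn_toLp

/-- The operator `T_ν = I_ν ∘ I_ν^* : L²(ν) → L²(ν)`. -/
def integralOp (hH : BoundedMeasurable (T := T) H) (ν : Measure T) [IsFiniteMeasure ν] :
    Lp ℝ 2 ν →L[ℝ] Lp ℝ 2 ν :=
  toL2 hH ν ∘L (toL2 hH ν).adjoint

/-- `ν` is `H`-positive: the embedding `I_ν : H → L²(ν)` is injective. -/
def IsPositiveFor (hH : BoundedMeasurable (T := T) H) (ν : Measure T) [IsFiniteMeasure ν] : Prop :=
  Function.Injective (toL2 hH ν)

/-- `(μ_i)` are the non-zero eigenvalues of `T_ν`, repeated according to their geometric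
multiplicities, and `(e_i)` is a family in `H` such that `([e_i])` is an orthonormal system in
`L²(ν)` and `[e_i]` is an eigenfunction of `T_ν` to the eigenvalue `μ_i`. -/
structure IsEigensystem (hH : BoundedMeasurable (T := T) H) (ν : Measure T) [IsFiniteMeasure ν]
    {ι : Type*} (μ : ι → ℝ) (e : ι → H) : Prop where
  ne_zero : ∀ i, μ i ≠ 0
  multiplicity : ∀ c : ℝ, c ≠ 0 → Set.encard {i | μ i = c} =
    Module.finrank ℝ (Module.End.eigenspace (integralOp hH ν : Lp ℝ 2 ν →ₗ[ℝ] Lp ℝ 2 ν) c)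
  orthonormal : Orthonormal ℝ fun i => toL2 hH ν (e i)
  eigen : ∀ i, integralOp hH ν (toL2 hH ν (e i)) = μ i • toL2 hH ν (e i)

variable {hH : BoundedMeasurable (T := T) H} {ν : Measure T} [IsFiniteMeasure ν]
  {ι : Type*} {μ : ι → ℝ} {e : ι → H}

lemma IsEigensystem.pos (he : IsEigensystem hH ν μ e) (i : ι) : 0 < μ i := by
  refine lt_of_le_of_ne ?_ (he.ne_zero i).symm
  have h1 : ⟪integralOp hH ν (toL2 hH ν (e i)), toL2 hH ν (e i)⟫_ℝ = μ i := by
    rw [he.eigen, real_inner_smul_left, real_inner_self_eq_norm_sq, he.orthonormal.1 i]; simp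
  rw [← h1, integralOp, ContinuousLinearMap.comp_apply,
    ← ContinuousLinearMap.adjoint_inner_right]
  exact real_inner_self_nonneg

lemma IsEigensystem.le_norm (he : IsEigensystem hH ν μ e) (i : ι) :
    μ i ≤ ‖integralOp hH ν‖ := by
  have h := (integralOp hH ν).le_opNorm (toL2 hH ν (e i))
  rw [he.eigen, norm_smul, he.orthonormal.1 i, mul_one, mul_one] at h
  exact (le_abs_self _).trans h

/-! ### The power spaces -/

/-- The summability condition `∑_i μ_i^β e_i(t)² < ∞` for all `t`. -/
def PowerSummable (μ : ι → ℝ) (e : ι → H) (β : ℝ) : Prop :=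
  ∀ t, Summable fun i => μ i ^ β * e i t ^ 2

/-- The sequence `(μ_i^{β/2} e_i(t))_i ∈ ℓ²(ι)`. -/
def powerFeature (he : IsEigensystem hH ν μ e) {β : ℝ} (hs : PowerSummable μ e β) (t : T) :
    lp (fun _ : ι => ℝ) 2 :=
  ⟨fun i => μ i ^ (β / 2) * e i t, by
    refine memℓp_gen ((hs t).congr fun i => ?_)
    have h0 := (he.pos i).le
    simp only [ENNReal.toReal_ofNat, Real.rpow_two, Real.norm_eq_abs, sq_abs]
    rw [mul_pow, ← Real.rpow_natCast (μ i ^ (β / 2)), ← Real.rpow_mul h0]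
    norm_num⟩

/-- For `a ∈ ℓ²(ι)` the series `∑_i a_i μ_i^{β/2} e_i(t)` converges, for every `t`. -/
lemma hasSum_power (he : IsEigensystem hH ν μ e) {β : ℝ} (hs : PowerSummable μ e β)
    (a : lp (fun _ : ι => ℝ) 2) (t : T) :
    HasSum (fun i => a i * (μ i ^ (β / 2) * e i t)) (∑' i, a i * (μ i ^ (β / 2) * e i t)) := by
  have h := lp.summable_inner (𝕜 := ℝ) (powerFeature he hs t) a
  exact (h.congr fun i => by simp [powerFeature]).hasSum

lemma inner_powerFeature (he : IsEigensystem hH ν μ e) {β : ℝ} (hs : PowerSummable μ e β)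
    (a : lp (fun _ : ι => ℝ) 2) (t : T) :
    ⟪powerFeature he hs t, a⟫_ℝ = ∑' i, a i * (μ i ^ (β / 2) * e i t) := by
  rw [lp.inner_eq_tsum]
  exact tsum_congr fun i => by simp [powerFeature]

/-- A family `a ∈ ℓ²(ι)` is determined by the function `∑_i a_i μ_i^{β/2} e_i`. -/
lemma eq_zero_of_power_eq_zero (he : IsEigensystem hH ν μ e) {β : ℝ} (hβ : 0 < β)
    (hs : PowerSummable μ e β) (a : lp (fun _ : ι => ℝ) 2)
    (h : ∀ t, ∑' i, a i * (μ i ^ (β / 2) * e i t) = 0) : a = 0 := by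
  -- the family `(a_i μ_i^{β/2})` is square summable since `(μ_i)` is bounded
  have hb : ∀ i, |μ i ^ (β / 2)| ≤ ‖integralOp hH ν‖ ^ (β / 2) := fun i => by
    rw [abs_of_nonneg (Real.rpow_nonneg (he.pos i).le _)]
    exact Real.rpow_le_rpow (he.pos i).le (he.le_norm i) (by positivity)
  let b : lp (fun _ : ι => ℝ) 2 := ⟨fun i => a i * μ i ^ (β / 2), by
    refine memℓp_gen ?_
    have ha := ((lp.memℓp a).summable (by norm_num)).mul_left
      ((‖integralOp hH ν‖ ^ (β / 2)) ^ 2)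
    refine ha.of_nonneg_of_le (fun i => by positivity) fun i => ?_
    simp only [ENNReal.toReal_ofNat, Real.rpow_two, norm_mul, mul_pow]
    rw [mul_comm]
    refine mul_le_mul_of_nonneg_right ?_ (sq_nonneg _)
    exact pow_le_pow_left₀ (norm_nonneg _) (hb i) 2⟩
  have hV := he.orthonormal.orthogonalFamily
  have hsum := hV.hasSum_linearIsometry b
  set g := hV.linearIsometry b with hg
  -- restrict to the countable support
  let S : Set ι := {i | a i ≠ 0}
  have hS : S.Countable := by
    have h1 := ((lp.memℓp a).summable (by norm_num)).countable_support
    refine h1.mono fun i hi => ?_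
    have : 0 < ‖a i‖ := norm_pos_iff.mpr hi
    exact (Real.rpow_pos_of_pos this _).ne'
  have : Countable S := hS.to_subtype
  have hsumS : HasSum (fun i : S => (a i * μ i ^ (β / 2)) • toL2 hH ν (e i)) g := by
    refine (hasSum_subtype_iff_of_support_subset (s := S)
      (f := fun i => (a i * μ i ^ (β / 2)) • toL2 hH ν (e i)) ?_).mpr hsum
    intro i hi hi0
    apply hi
    have : a i = 0 := by simpa [S] using hi0
    simp [this]
  obtain ⟨ns, hns, hae⟩ := (tendstoInMeasure_of_tendsto_Lp hsumS).exists_seq_tendsto_ae'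
  have hpt : ∀ t, Tendsto (fun s : Finset S => ∑ i ∈ s, (a i * μ i ^ (β / 2)) * e i t)
      atTop (𝓝 0) := fun t => by
    have h1 := hasSum_power he hs a t
    rw [h t] at h1
    have h2 : HasSum (fun i : S => (a i * (μ i ^ (β / 2) * e i t))) 0 := by
      refine (hasSum_subtype_iff_of_support_subset (s := S)
        (f := fun i => a i * (μ i ^ (β / 2) * e i t)) ?_).mpr h1
      intro i hi hi0
      apply hi
      have : a i = 0 := by simpa [S] using hi0
      simp [this]
    simp only [mul_assoc]
    exact h2
  have hcoe : ∀ n, ((∑ i ∈ ns n, (a i * μ i ^ (β / 2)) • toL2 hH ν (e i) : Lp ℝ 2 ν) : T → ℝ)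
      =ᵐ[ν] fun t => ∑ i ∈ ns n, (a i * μ i ^ (β / 2)) * e i t := fun n => by
    have h1 : (∑ i ∈ ns n, (a i * μ i ^ (β / 2)) • toL2 hH ν (e i) : Lp ℝ 2 ν)
        = toL2 hH ν (∑ i ∈ ns n, (a i * μ i ^ (β / 2)) • e i) := by simp
    rw [h1]
    filter_upwards [coeFn_toL2 hH ν (∑ i ∈ ns n, (a i * μ i ^ (β / 2)) • e i)] with t ht
    rw [ht]
    refine (map_sum (ContinuousLinearMap.proj t ∘L RKHS.coeCLM ℝ (H := H) : H →L[ℝ] ℝ)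
      (fun i : S => (a i * μ i ^ (β / 2)) • e i) (ns n)).trans ?_
    exact Finset.sum_congr rfl fun i _ => by simp
  have hg0 : g = 0 := by
    refine (Lp.eq_zero_iff_ae_eq_zero).mpr ?_
    filter_upwards [hae, ae_all_iff.mpr hcoe] with t ht1 ht2
    refine tendsto_nhds_unique ht1 ?_
    simp only [ht2]
    exact (hpt t).comp hns
  have hb0 : b = 0 := by
    rw [hg0] at hg
    exact hV.linearIsometry.injective (hg.symm.trans (map_zero _).symm)
  ext i
  have hbi : a i * μ i ^ (β / 2) = 0 := congrFun (congrArg Subtype.val hb0) i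
  simpa using (mul_eq_zero.mp hbi).resolve_right (Real.rpow_pos_of_pos (he.pos i) _).ne'

/-- The space `H^β = {∑_i a_i μ_i^{β/2} e_i : a ∈ ℓ²(ι)}` with the norm that makes
`(μ_i^{β/2} e_i)` an orthonormal basis. An element is stored as its coefficient family
`a ∈ ℓ²(ι)`, which the function determines. -/
def PowerSpace (_he : IsEigensystem hH ν μ e) {β : ℝ} (_hβ : 0 < β)
    (_hs : PowerSummable μ e β) : Type _ :=
  lp (fun _ : ι => ℝ) 2

section Instances

variable (he : IsEigensystem hH ν μ e) {β : ℝ} (hβ : 0 < β) (hs : PowerSummable μ e β)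

instance : NormedAddCommGroup (PowerSpace he hβ hs) :=
  inferInstanceAs (NormedAddCommGroup (lp (fun _ : ι => ℝ) 2))

instance : InnerProductSpace ℝ (PowerSpace he hβ hs) :=
  inferInstanceAs (InnerProductSpace ℝ (lp (fun _ : ι => ℝ) 2))

instance : CompleteSpace (PowerSpace he hβ hs) :=
  inferInstanceAs (CompleteSpace (lp (fun _ : ι => ℝ) 2))

instance : RKHS ℝ (PowerSpace he hβ hs) T ℝ where
  coeCLM := show lp (fun _ : ι => ℝ) 2 →L[ℝ] T → ℝ from
    { toFun := fun a t => ∑' i, a i * (μ i ^ (β / 2) * e i t)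
      map_add' := fun a b => by
        ext t; simp only [← inner_powerFeature he hs, inner_add_right, Pi.add_apply]
      map_smul' := fun c a => by
        ext t
        simp only [← inner_powerFeature he hs, inner_smul_right, Pi.smul_apply, smul_eq_mul,
          RingHom.id_apply]
      cont := by
        refine continuous_pi fun t => ?_
        simp only [← inner_powerFeature he hs]
        fun_prop }
  coeCLM_injective := by
    refine (injective_iff_map_eq_zero _).mpr fun a ha => ?_
    exact eq_zero_of_power_eq_zero he hβ hs a fun t => congrFun ha t

/-- The functions in `H^β` are exactly the sums `∑_i a_i μ_i^{β/2} e_i` with `a ∈ ℓ²(ι)`. -/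
lemma powerSpace_apply (a : PowerSpace he hβ hs) (t : T) :
    a t = ∑' i, (show lp (fun _ : ι => ℝ) 2 from a) i * (μ i ^ (β / 2) * e i t) :=
  rfl

end Instances

end Embedding

end GaussianPaths

end

/-! Write I for the embedding into L²(ν) and T = I I^*. Boundedness of the functions in H bounds the
kernel functions k_t uniformly in norm, so I is Hilbert-Schmidt and T is compact and symmetric
(`summable_norm_toL2_sq`, `isCompactOperator_integralOp`). The multiplicity condition then forces
the [e_i] to exhaust all eigenspaces for non-zero eigenvalues, so I^* vanishes on their orthogonal
complement (`adjoint_eq_zero`). This gives the singular value decomposition I h = ∑ √μ_i ⟪u_i, h⟫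
[e_i] with u_i = μ_i^{-1/2} I^*[e_i] orthonormal.

(i) If ∑ √μ_i < ∞, the decomposition is a nuclear representation. Conversely, √μ_i = ⟪[e_i], I u_i⟫,
and summing these diagonal entries over any nuclear representation bounds ∑ √μ_i.

(ii) If I is injective, then u_i = √μ_i e_i is an orthonormal basis of H. Relative to the basis
μ_i^{β/2} e_i of H^β the inclusion is diagonal with entries μ_i^{(1-β)/2}, so its squared
Hilbert-Schmidt norm is ∑ μ_i^{1-β}. For the paths, the Loève map carries u_i to ξ_i ∈ L²(P) and
gives X_t = ∑ √μ_i e_i(t) ξ_i. The coefficients in H^β are μ_i^{(1-β)/2} ξ_i, and the sum of their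
squares has expectation at most ∑ μ_i^{1-β}, hence is a.s. finite. -/

noncomputable section

namespace GaussianPaths

/-! ### Hilbert-Schmidt operators and orthonormal expansions -/

section Hilbert

variable {E F : Type*} [NormedAddCommGroup E] [InnerProductSpace ℝ E]
  [NormedAddCommGroup F] [InnerProductSpace ℝ F] {ι : Type*}

/-- Cauchy-Schwarz and Bessel for a finite sum of rank-one operators. -/
lemma norm_sum_smulRight_le {b : ι → E} (hb : Orthonormal ℝ b) (y : ι → F) (s : Finset ι) :
    ‖∑ i ∈ s, (innerSL ℝ (b i)).smulRight (y i)‖ ≤ √(∑ i ∈ s, ‖y i‖ ^ 2) := by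
  refine ContinuousLinearMap.opNorm_le_bound _ (Real.sqrt_nonneg _) fun x => ?_
  have h1 : (∑ i ∈ s, (innerSL ℝ (b i)).smulRight (y i)) x = ∑ i ∈ s, ⟪b i, x⟫_ℝ • y i := by
    simp
  rw [h1]
  calc ‖∑ i ∈ s, ⟪b i, x⟫_ℝ • y i‖ ≤ ∑ i ∈ s, ‖y i‖ * ‖⟪b i, x⟫_ℝ‖ :=
        norm_sum_le_of_le _ fun i _ => by rw [norm_smul, mul_comm]
    _ ≤ √(∑ i ∈ s, ‖y i‖ ^ 2) * √(∑ i ∈ s, ‖⟪b i, x⟫_ℝ‖ ^ 2) :=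
        Real.sum_mul_le_sqrt_mul_sqrt s _ _
    _ ≤ √(∑ i ∈ s, ‖y i‖ ^ 2) * ‖x‖ := by
        gcongr
        exact Real.sqrt_le_iff.mpr ⟨norm_nonneg _, hb.sum_inner_products_le x⟩

/-- A Hilbert-Schmidt operator is compact. -/
lemma isCompactOperator_of_summable [CompleteSpace F] (b : HilbertBasis ι ℝ E) (S : E →L[ℝ] F)
    (hS : Summable fun i => ‖S (b i)‖ ^ 2) : IsCompactOperator S := by
  -- Cauchy criterion in operator norm: the tails of the rank-one series are bounded by the square
  -- roots of the tails of ∑ ‖S b_i‖².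
  have hsum : Summable fun i => (innerSL ℝ (b i)).smulRight (S (b i)) := by
    refine summable_iff_vanishing_norm.mpr fun ε hε => ?_
    obtain ⟨s, hs⟩ := summable_iff_vanishing_norm.mp hS (ε ^ 2) (by positivity)
    refine ⟨s, fun t ht => (norm_sum_smulRight_le b.orthonormal _ t).trans_lt ?_⟩
    rw [Real.sqrt_lt' hε]
    exact (le_abs_self _).trans_lt (hs t ht)
  have heq : ∑' i, (innerSL ℝ (b i)).smulRight (S (b i)) = S := by
    ext x
    have h1 := hsum.hasSum.mapL (ContinuousLinearMap.apply ℝ F x)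
    have h2 := (b.hasSum_repr x).mapL S
    refine h1.unique ?_
    convert! h2 using 1
    ext i
    simp [b.repr_apply_apply]
  refine isCompactOperator_of_tendsto (heq ▸ hsum.hasSum) (Eventually.of_forall fun s => ?_)
  refine Submodule.sum_mem (compactOperator (RingHom.id ℝ) E F) fun i _ => ?_
  exact (isCompactOperator_of_locallyCompactSpace_dom (innerSL ℝ (b i))).clm_comp
    (ContinuousLinearMap.toSpanSingleton ℝ (S (b i)))

/-- A Hilbert basis indexed by any type witnesses the Hilbert-Schmidt property. -/
lemma IsHilbertSchmidt.of_hilbertBasis [CompleteSpace E] (b : HilbertBasis ι ℝ E) (S : E →L[ℝ] F)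
    (hS : Summable fun i => ‖S (b i)‖ ^ 2) : IsHilbertSchmidt S := by
  refine ⟨Set.range b, HilbertBasis.mk b.orthonormal.toSubtypeRange ?_, ?_⟩
  · rw [Subtype.range_coe, b.dense_span]
  · rw [HilbertBasis.coe_mk,
      ← (Equiv.ofInjective b b.orthonormal.linearIndependent.injective).summable_iff]
    exact hS

/-- Expansion along an orthonormal system of a vector orthogonal to its orthogonal complement. -/
lemma hasSum_inner_smul_of_orthonormal [CompleteSpace F] {v : ι → F} (hv : Orthonormal ℝ v)
    {y : F} (hy : ∀ x, (∀ i, ⟪v i, x⟫_ℝ = 0) → ⟪x, y⟫_ℝ = 0) :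
    HasSum (fun i => ⟪v i, y⟫_ℝ • v i) y := by
  classical
  have hsum : Summable fun i => ⟪v i, y⟫_ℝ • v i := by
    have := (hv.orthogonalFamily.summable_iff_norm_sq_summable (fun i => ⟪v i, y⟫_ℝ)).mpr
      (hv.inner_products_summable y)
    simpa using this
  obtain ⟨z, hz⟩ := hsum
  have hvz : ∀ i, ⟪v i, z⟫_ℝ = ⟪v i, y⟫_ℝ := fun i => by
    have h1 := hz.mapL (innerSL ℝ (v i))
    refine h1.unique ?_
    convert! hasSum_ite_eq i ⟪v i, y⟫_ℝ using 1
    ext j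
    by_cases hij : j = i
    · subst hij; simp [hv.1 j]
    · simp [hij, hv.2 (Ne.symm hij)]
  -- The residual y - z is orthogonal to every v_i, hence to y by `hy` and to z as a limit of
  -- combinations of the v_i; so it is orthogonal to itself.
  have hw : ∀ i, ⟪v i, y - z⟫_ℝ = 0 := fun i => by rw [inner_sub_right, hvz, sub_self]
  have hwz : ⟪y - z, z⟫_ℝ = 0 := by
    have h1 := hz.mapL (innerSL ℝ (y - z))
    refine h1.unique ?_
    convert! hasSum_zero using 1
    ext i
    simp only [innerSL_apply_apply, real_inner_smul_right]
    rw [real_inner_comm (v i) (y - z), hw, mul_zero]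
  have hyz : y - z = 0 := by
    rw [← inner_self_eq_zero (𝕜 := ℝ), inner_sub_right, hy _ hw, hwz, sub_zero]
  simpa only [← sub_eq_zero.mp hyz] using hz

/-- Norms of linear combinations depend only on the Gram matrix. This makes u_i ↦ v_i a well-defined
isometry between the spans. -/
lemma norm_linearCombination_eq {u : ι → E} {v : ι → F}
    (h : ∀ i j, ⟪u i, u j⟫_ℝ = ⟪v i, v j⟫_ℝ) (c : ι →₀ ℝ) :
    ‖Finsupp.linearCombination ℝ u c‖ = ‖Finsupp.linearCombination ℝ v c‖ := by
  rw [← sq_eq_sq₀ (norm_nonneg _) (norm_nonneg _), ← real_inner_self_eq_norm_sq,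
    ← real_inner_self_eq_norm_sq]
  simp only [Finsupp.linearCombination_apply, Finsupp.sum_inner, Finsupp.inner_sum,
    real_inner_smul_left, real_inner_smul_right, h]

end Hilbert

/-! ### Compactness and the singular value decomposition of the embedding -/

section Eigensystem

variable {T : Type*} [MeasurableSpace T] {H : Type*} [NormedAddCommGroup H]
  [InnerProductSpace ℝ H] [RKHS ℝ H T ℝ] [CompleteSpace H]
  {hH : BoundedMeasurable (T := T) H} {ν : Measure T} [IsFiniteMeasure ν]
  {ι : Type*} {μ : ι → ℝ} {e : ι → H}

lemma norm_toL2_sq (hH : BoundedMeasurable (T := T) H) (ν : Measure T) [IsFiniteMeasure ν]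
    (h : H) : ‖toL2 hH ν h‖ ^ 2 = ∫ t, h t ^ 2 ∂ν := by
  rw [← real_inner_self_eq_norm_sq, L2.inner_def]
  refine integral_congr_ae ?_
  filter_upwards [coeFn_toL2 hH ν h] with t ht
  simp [ht, sq]

lemma inner_kerFun_one {T H : Type*} [NormedAddCommGroup H] [InnerProductSpace ℝ H]
    [CompleteSpace H] [RKHS ℝ H T ℝ] (h : H) (t : T) : ⟪RKHS.kerFun H t (1 : ℝ), h⟫_ℝ = h t := by
  simp

/-- The embedding into `L²(ν)` satisfies the Hilbert-Schmidt bound along orthonormal systems. -/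
lemma summable_norm_toL2_sq (hH : BoundedMeasurable (T := T) H) (ν : Measure T)
    [IsFiniteMeasure ν] {b : ι → H} (hb : Orthonormal ℝ b) :
    Summable fun i => ‖toL2 hH ν (b i)‖ ^ 2 := by
  obtain ⟨C, hC0, hC⟩ := hH.exists_bound
  -- Evaluating k_t at t gives ‖k_t‖² = k_t(t) ≤ C ‖k_t‖.
  have hk : ∀ t, ‖RKHS.kerFun H t (1 : ℝ)‖ ≤ C := fun t => by
    have h1 := hC (RKHS.kerFun H t (1 : ℝ)) t
    rw [← inner_kerFun_one (H := H), real_inner_self_eq_norm_sq,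
      abs_of_nonneg (sq_nonneg _), sq] at h1
    by_contra! h2
    exact absurd (le_of_mul_le_mul_right h1 (hC0.trans_lt h2)) h2.not_ge
  have hi : ∀ h : H, Integrable (fun t => h t ^ 2) ν := fun h => (hH.memLp ν h).integrable_sq
  -- Pointwise in t, b_i(t) = ⟪k_t, b_i⟫, so Bessel gives ∑ b_i(t)² ≤ ‖k_t‖² ≤ C²; then integrate.
  refine summable_of_sum_le (c := ∫ _, C ^ 2 ∂ν) (fun i => sq_nonneg _) fun s => ?_
  simp_rw [norm_toL2_sq]
  rw [← integral_finsetSum _ fun i _ => hi (b i)]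
  refine integral_mono (integrable_finsetSum _ fun i _ => hi (b i)) (integrable_const _) fun t => ?_
  have h1 := hb.sum_inner_products_le (s := s) (RKHS.kerFun H t (1 : ℝ))
  simp only [Real.norm_eq_abs, sq_abs] at h1
  refine le_trans (le_of_eq ?_) (h1.trans (pow_le_pow_left₀ (norm_nonneg _) (hk t) 2))
  refine Finset.sum_congr rfl fun i _ => ?_
  rw [← inner_kerFun_one (H := H) (b i) t, real_inner_comm]

lemma isCompactOperator_toL2 (hH : BoundedMeasurable (T := T) H) (ν : Measure T)
    [IsFiniteMeasure ν] : IsCompactOperator (toL2 hH ν) := by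
  obtain ⟨w, b, -⟩ := exists_hilbertBasis ℝ H
  exact isCompactOperator_of_summable b _ (summable_norm_toL2_sq hH ν b.orthonormal)

lemma isCompactOperator_integralOp (hH : BoundedMeasurable (T := T) H) (ν : Measure T)
    [IsFiniteMeasure ν] : IsCompactOperator (integralOp hH ν) :=
  (isCompactOperator_toL2 hH ν).comp_clm (toL2 hH ν).adjoint

lemma inner_integralOp (hH : BoundedMeasurable (T := T) H) (ν : Measure T)
    [IsFiniteMeasure ν] (x y : Lp ℝ 2 ν) :
    ⟪integralOp hH ν x, y⟫_ℝ = ⟪(toL2 hH ν).adjoint x, (toL2 hH ν).adjoint y⟫_ℝ := by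
  rw [integralOp, ContinuousLinearMap.comp_apply, ContinuousLinearMap.adjoint_inner_right]

lemma isSymmetric_integralOp (hH : BoundedMeasurable (T := T) H) (ν : Measure T)
    [IsFiniteMeasure ν] : (integralOp hH ν : Lp ℝ 2 ν →ₗ[ℝ] Lp ℝ 2 ν).IsSymmetric := fun x y => by
  change ⟪integralOp hH ν x, y⟫_ℝ = ⟪x, integralOp hH ν y⟫_ℝ
  rw [inner_integralOp, ← real_inner_comm, ← inner_integralOp, real_inner_comm]

namespace IsEigensystem

/-- The eigenspace to `c ≠ 0` is spanned by the `[e_i]` with `μ_i = c`. -/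
lemma eigenspace_le (he : IsEigensystem hH ν μ e) {c : ℝ} (hc : c ≠ 0) :
    Module.End.eigenspace (integralOp hH ν : Lp ℝ 2 ν →ₗ[ℝ] Lp ℝ 2 ν) c ≤
      Submodule.span ℝ (Set.range fun i => toL2 hH ν (e i)) := by
  -- Compactness is essential here: on an infinite-dimensional eigenspace `finrank` would take its
  -- default value 0 and the multiplicity condition would not count a basis.
  have hfd := ContinuousLinearMap.finite_dimensional_eigenspace
    (isCompactOperator_integralOp hH ν) c hc
  set V := Module.End.eigenspace (integralOp hH ν : Lp ℝ 2 ν →ₗ[ℝ] Lp ℝ 2 ν) c with hV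
  have hcard := he.multiplicity c hc
  have hfin : {i | μ i = c}.Finite := by
    rw [← Set.encard_lt_top_iff, hcard]; exact ENat.natCast_lt_top _
  have := hfin.fintype
  let v : {i | μ i = c} → V := fun i => ⟨toL2 hH ν (e i), by
    rw [hV, Module.End.mem_eigenspace_iff]
    have := he.eigen i
    rwa [i.2] at this⟩
  have hli : LinearIndependent ℝ v := by
    refine LinearIndependent.of_comp V.subtype ?_
    exact he.orthonormal.linearIndependent.comp (Subtype.val : {i | μ i = c} → ι)
      Subtype.val_injective
  have hspan := hli.span_eq_top_of_card_eq_finrank' (by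
    have h1 := hcard
    rw [← Set.coe_fintypeCard] at h1
    exact_mod_cast h1)
  intro x hx
  have h1 : (⟨x, hx⟩ : V) ∈ Submodule.span ℝ (Set.range v) := hspan ▸ Submodule.mem_top
  have h2 := Submodule.mem_map_of_mem (f := V.subtype) h1
  rw [Submodule.map_span] at h2
  refine Submodule.span_mono ?_ h2
  rintro _ ⟨_, ⟨i, rfl⟩, rfl⟩
  exact ⟨i, rfl⟩

/-- The adjoint of the embedding vanishes on the orthogonal complement of the `[e_i]`. -/
lemma adjoint_eq_zero (he : IsEigensystem hH ν μ e) {x : Lp ℝ 2 ν}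
    (hx : ∀ i, ⟪toL2 hH ν (e i), x⟫_ℝ = 0) : (toL2 hH ν).adjoint x = 0 := by
  have hperp : ∀ y ∈ Submodule.span ℝ (Set.range fun i => toL2 hH ν (e i)), ⟪y, x⟫_ℝ = 0 := by
    intro y hy
    induction hy using Submodule.span_induction with
    | mem y hy => obtain ⟨i, rfl⟩ := hy; exact hx i
    | zero => exact inner_zero_left _
    | add y z _ _ h1 h2 => rw [inner_add_left, h1, h2, add_zero]
    | smul r y _ h1 => rw [real_inner_smul_left, h1, mul_zero]
  -- For y in the eigenspace to c, ⟪y, T x⟫ = c ⟪y, x⟫, which vanishes either because c = 0 or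
  -- because y lies in the span of the [e_i]. The eigenspaces are total, so T x = 0, and then ‖I^*
  -- x‖² = ⟪T x, x⟫ = 0.
  have hT : integralOp hH ν x ∈
      (⨆ c, Module.End.eigenspace (integralOp hH ν : Module.End ℝ (Lp ℝ 2 ν)) c)ᗮ := by
    rw [← Submodule.iInf_orthogonal, Submodule.mem_iInf]
    intro c y hy
    have hy' : integralOp hH ν y = c • y := Module.End.mem_eigenspace_iff.mp hy
    have h1 : ⟪y, integralOp hH ν x⟫_ℝ = c * ⟪y, x⟫_ℝ := by
      rw [← real_inner_smul_left, ← hy']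
      exact (isSymmetric_integralOp hH ν y x).symm
    rw [h1]
    by_cases hc : c = 0
    · rw [hc, zero_mul]
    · rw [hperp y (he.eigenspace_le hc hy), mul_zero]
  rw [ContinuousLinearMap.orthogonalComplement_iSup_eigenspaces_eq_bot
    (isCompactOperator_integralOp hH ν) (isSymmetric_integralOp hH ν), Submodule.mem_bot] at hT
  rw [← inner_self_eq_zero (𝕜 := ℝ), ← inner_integralOp, hT, inner_zero_left]

/-- A vector orthogonal to all [e_i] is killed by I^*, hence is orthogonal to the range of I. -/
lemma hasSum_toL2 (he : IsEigensystem hH ν μ e) (h : H) :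
    HasSum (fun i => ⟪toL2 hH ν (e i), toL2 hH ν h⟫_ℝ • toL2 hH ν (e i)) (toL2 hH ν h) :=
  hasSum_inner_smul_of_orthonormal he.orthonormal fun x hx => by
    rw [← ContinuousLinearMap.adjoint_inner_left, he.adjoint_eq_zero hx, inner_zero_left]

/-- The right singular vectors `μ_i^{-1/2} I^*[e_i]` of the embedding. -/
def singularVector (_he : IsEigensystem hH ν μ e) (i : ι) : H :=
  (√(μ i))⁻¹ • (toL2 hH ν).adjoint (toL2 hH ν (e i))

lemma inner_toL2 (he : IsEigensystem hH ν μ e) (i : ι) (h : H) :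
    ⟪toL2 hH ν (e i), toL2 hH ν h⟫_ℝ = √(μ i) * ⟪he.singularVector i, h⟫_ℝ := by
  rw [singularVector, real_inner_smul_left, ContinuousLinearMap.adjoint_inner_left,
    mul_inv_cancel_left₀ (Real.sqrt_pos.mpr (he.pos i)).ne']

lemma toL2_singularVector (he : IsEigensystem hH ν μ e) (i : ι) :
    toL2 hH ν (he.singularVector i) = √(μ i) • toL2 hH ν (e i) := by
  have h1 : toL2 hH ν ((toL2 hH ν).adjoint (toL2 hH ν (e i))) = μ i • toL2 hH ν (e i) :=
    he.eigen i
  rw [singularVector, map_smul, h1, smul_smul]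
  congr 1
  rw [inv_mul_eq_div, Real.div_sqrt]

lemma orthonormal_singularVector (he : IsEigensystem hH ν μ e) :
    Orthonormal ℝ he.singularVector := by
  classical
  rw [orthonormal_iff_ite]
  intro i j
  have h1 := he.inner_toL2 i (he.singularVector j)
  have hpos : ∀ i, √(μ i) ≠ 0 := fun i => (Real.sqrt_pos.mpr (he.pos i)).ne'
  rw [toL2_singularVector, real_inner_smul_right, orthonormal_iff_ite.mp he.orthonormal] at h1
  by_cases hij : i = j
  · subst hij
    simpa [hpos i] using h1
  · simpa [hij, hpos i] using h1

/-- Both sides have the same image under I. Without injectivity the representatives e_i are fixed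
only modulo ker I, which is why the nuclearity argument uses the singular vectors instead. -/
lemma singularVector_eq (he : IsEigensystem hH ν μ e) (hν : IsPositiveFor hH ν) (i : ι) :
    he.singularVector i = √(μ i) • e i :=
  hν (by rw [toL2_singularVector, map_smul])

/-- If the embedding is injective, then `(√μ_i e_i)` is an orthonormal basis. -/
def hilbertBasis (he : IsEigensystem hH ν μ e) (hν : IsPositiveFor hH ν) : HilbertBasis ι ℝ H :=
  HilbertBasis.mkOfOrthogonalEqBot he.orthonormal_singularVector (by
    rw [Submodule.eq_bot_iff]
    intro h hh
    refine hν ?_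
    rw [map_zero]
    refine (he.hasSum_toL2 h).unique ?_
    convert! hasSum_zero using 1
    ext1 i
    rw [he.inner_toL2, (Submodule.mem_orthogonal _ _).mp hh _ (Submodule.subset_span ⟨i, rfl⟩),
      mul_zero, zero_smul])

lemma hilbertBasis_apply (he : IsEigensystem hH ν μ e) (hν : IsPositiveFor hH ν) (i : ι) :
    he.hilbertBasis hν i = √(μ i) • e i := by
  rw [hilbertBasis, HilbertBasis.coe_mkOfOrthogonalEqBot, singularVector_eq he hν]

lemma hasSum_apply (he : IsEigensystem hH ν μ e) (hν : IsPositiveFor hH ν) (h : H) (t : T) :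
    HasSum (fun i => ⟪he.hilbertBasis hν i, h⟫_ℝ * (√(μ i) * e i t)) (h t) := by
  have h1 := ((he.hilbertBasis hν).hasSum_repr h).mapL (innerSL ℝ (RKHS.kerFun H t (1 : ℝ)))
  simp only [innerSL_apply_apply, inner_kerFun_one] at h1
  convert! h1 using 1
  ext i
  rw [HilbertBasis.repr_apply_apply, RKHS.coe_smul, hilbertBasis_apply, RKHS.coe_smul]
  rfl

end IsEigensystem

end Eigensystem

/-! ### Nuclearity, and Hilbert-Schmidt inclusion into the power space -/

section Dominance

variable {T : Type*} [MeasurableSpace T] {H : Type*} [NormedAddCommGroup H]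
  [InnerProductSpace ℝ H] [RKHS ℝ H T ℝ] [CompleteSpace H]
  {hH : BoundedMeasurable (T := T) H} {ν : Measure T} [IsFiniteMeasure ν]
  {ι : Type*} {μ : ι → ℝ} {e : ι → H}

namespace IsEigensystem

lemma isNuclear_of_summable (he : IsEigensystem hH ν μ e) (hs : Summable fun i => √(μ i)) :
    IsNuclear (toL2 hH ν) := by
  have hc : Countable ι := by
    rw [← Set.countable_univ_iff]
    exact hs.countable_support.mono fun i _ => (Real.sqrt_pos.mpr (he.pos i)).ne'
  obtain ⟨g, hg⟩ := exists_injective_nat ι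
  let φ : ι → H →L[ℝ] ℝ := fun i => √(μ i) • innerSL ℝ (he.singularVector i)
  let v : ι → Lp ℝ 2 ν := fun i => toL2 hH ν (e i)
  -- `IsNuclear` asks for a series over ℕ, so the decomposition is transported along an injection ι
  -- → ℕ and padded with zeros.
  have hout : ∀ n, (∀ i, g i ≠ n) → Function.extend g φ 0 n = 0 := fun n hn =>
    Function.extend_apply' _ _ _ fun ⟨i, hi⟩ => hn i hi
  refine ⟨Function.extend g φ 0, Function.extend g v 0, ?_, fun x => ?_⟩
  · refine (hg.summable_iff fun n hn => ?_).mp ?_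
    · rw [hout n fun i hi => hn ⟨i, hi⟩, norm_zero, zero_mul]
    · refine hs.congr fun i => ?_
      simp only [Function.comp_apply, hg.extend_apply]
      rw [he.orthonormal.1 i, mul_one, norm_smul, innerSL_apply_norm,
        he.orthonormal_singularVector.1 i, mul_one, Real.norm_of_nonneg (Real.sqrt_nonneg _)]
  · refine (hg.hasSum_iff fun n hn => ?_).mp ?_
    · rw [hout n fun i hi => hn ⟨i, hi⟩, zero_apply, zero_smul]
    · convert! he.hasSum_toL2 x using 1
      ext1 i
      rw [he.inner_toL2]
      simp only [Function.comp_apply, hg.extend_apply]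
      rfl

/-- A trace estimate: each √μ_i equals ∑_n φ_n(u_i) ⟪[e_i], y_n⟫. Summing over finitely many i,
Cauchy-Schwarz and Bessel for both orthonormal systems bound the n-th term by ‖φ_n‖ ‖y_n‖. -/
lemma summable_of_isNuclear (he : IsEigensystem hH ν μ e) (hN : IsNuclear (toL2 hH ν)) :
    Summable fun i => √(μ i) := by
  obtain ⟨φ, y, hsum, hφ⟩ := hN
  refine summable_of_sum_le (c := ∑' n, ‖φ n‖ * ‖y n‖) (fun i => Real.sqrt_nonneg _) fun s => ?_
  have h1 : ∀ i, HasSum (fun n => φ n (he.singularVector i) * ⟪toL2 hH ν (e i), y n⟫_ℝ)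
      √(μ i) := fun i => by
    have h2 := (hφ (he.singularVector i)).mapL (innerSL ℝ (toL2 hH ν (e i)))
    rw [innerSL_apply_apply, he.toL2_singularVector, real_inner_smul_right,
      real_inner_self_eq_norm_sq, he.orthonormal.1 i, one_pow, mul_one] at h2
    simpa only [innerSL_apply_apply, real_inner_smul_right] using h2
  refine hasSum_le (fun n => ?_) (hasSum_sum fun i (_ : i ∈ s) => h1 i) hsum.hasSum
  refine (Real.sum_mul_le_sqrt_mul_sqrt s _ _).trans ?_
  gcongr
  · refine Real.sqrt_le_iff.mpr ⟨norm_nonneg _, ?_⟩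
    have h2 := he.orthonormal_singularVector.sum_inner_products_le (s := s)
      ((InnerProductSpace.toDual ℝ H).symm (φ n))
    simpa only [real_inner_comm ((InnerProductSpace.toDual ℝ H).symm (φ n)),
      InnerProductSpace.toDual_symm_apply, LinearIsometryEquiv.norm_map, Real.norm_eq_abs,
      sq_abs] using h2
  · refine Real.sqrt_le_iff.mpr ⟨norm_nonneg _, ?_⟩
    simpa using he.orthonormal.sum_inner_products_le (s := s) (y n)

/-- The coefficient map `h ↦ (μ_i^{(1-β)/2} ⟪√μ_i e_i, h⟫)_i`. -/
def powerCoeff (he : IsEigensystem hH ν μ e) (hν : IsPositiveFor hH ν) {β : ℝ} (hβ : β < 1) :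
    H →L[ℝ] lp (fun _ : ι => ℝ) 2 :=
  -- This bound, from μ_i ≤ ‖T‖ and Bessel, gives both membership in ℓ² and continuity.
  have hb : ∀ (h : H) (s : Finset ι),
      ∑ i ∈ s, ‖μ i ^ ((1 - β) / 2) * ⟪he.hilbertBasis hν i, h⟫_ℝ‖ ^ (2 : ENNReal).toReal ≤
        (‖integralOp hH ν‖ ^ ((1 - β) / 2) * ‖h‖) ^ (2 : ENNReal).toReal := fun h s => by
    simp only [ENNReal.toReal_ofNat, Real.rpow_two, norm_mul, mul_pow]
    calc _ ≤ ∑ i ∈ s, (‖integralOp hH ν‖ ^ ((1 - β) / 2)) ^ 2 *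
          ‖⟪he.hilbertBasis hν i, h⟫_ℝ‖ ^ 2 := by
          gcongr with i
          rw [Real.norm_of_nonneg (Real.rpow_nonneg (he.pos i).le _)]
          exact Real.rpow_le_rpow (he.pos i).le (he.le_norm i) (by linarith)
      _ ≤ _ := by
          rw [← Finset.mul_sum]
          gcongr
          exact (he.hilbertBasis hν).orthonormal.sum_inner_products_le h
  LinearMap.mkContinuous
    { toFun := fun h => ⟨fun i => μ i ^ ((1 - β) / 2) * ⟪he.hilbertBasis hν i, h⟫_ℝ,
        memℓp_gen' (hb h)⟩
      map_add' := fun f g => by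
        ext i; simp only [inner_add_right, mul_add]; rfl
      map_smul' := fun c f => by
        ext i; simp only [real_inner_smul_right, mul_left_comm]; rfl }
    (‖integralOp hH ν‖ ^ ((1 - β) / 2))
    fun h => lp.norm_le_of_forall_sum_le (by norm_num) (by positivity) (hb h)

lemma powerCoeff_apply (he : IsEigensystem hH ν μ e) (hν : IsPositiveFor hH ν) {β : ℝ}
    (hβ : β < 1) (h : H) (i : ι) :
    he.powerCoeff hν hβ h i = μ i ^ ((1 - β) / 2) * ⟪he.hilbertBasis hν i, h⟫_ℝ :=
  rfl

lemma rpow_mul_rpow_eq_sqrt (he : IsEigensystem hH ν μ e) (β : ℝ) (i : ι) :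
    μ i ^ ((1 - β) / 2) * μ i ^ (β / 2) = √(μ i) := by
  rw [← Real.rpow_add (he.pos i), Real.sqrt_eq_rpow]
  congr 1
  ring

lemma rpow_half_sq (he : IsEigensystem hH ν μ e) (β : ℝ) (i : ι) :
    (μ i ^ ((1 - β) / 2)) ^ 2 = μ i ^ (1 - β) := by
  rw [← Real.rpow_natCast, ← Real.rpow_mul (he.pos i).le]
  norm_num

/-- The inclusion `H → H^β`. -/
def powerEmbedding (he : IsEigensystem hH ν μ e) (hν : IsPositiveFor hH ν) {β : ℝ} (hβ : 0 < β)
    (hβ1 : β < 1) (hs : PowerSummable μ e β) : H →L[ℝ] PowerSpace he hβ hs :=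
  he.powerCoeff hν hβ1

lemma powerEmbedding_apply (he : IsEigensystem hH ν μ e) (hν : IsPositiveFor hH ν) {β : ℝ}
    (hβ : 0 < β) (hβ1 : β < 1) (hs : PowerSummable μ e β) (h : H) (t : T) :
    he.powerEmbedding hν hβ hβ1 hs h t = h t := by
  rw [powerSpace_apply, ← (he.hasSum_apply hν h t).tsum_eq]
  refine tsum_congr fun i => ?_
  change he.powerCoeff hν hβ1 h i * _ = _
  rw [powerCoeff_apply, ← he.rpow_mul_rpow_eq_sqrt β i]
  ring

/-- The inclusion is diagonal since √μ_i e_i = μ_i^{(1-β)/2} · μ_i^{β/2} e_i. -/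
lemma powerCoeff_hilbertBasis [DecidableEq ι] (he : IsEigensystem hH ν μ e)
    (hν : IsPositiveFor hH ν) {β : ℝ} (hβ : β < 1) (i : ι) :
    he.powerCoeff hν hβ (he.hilbertBasis hν i) =
      lp.single 2 i (μ i ^ ((1 - β) / 2)) := by
  ext j
  rw [powerCoeff_apply, orthonormal_iff_ite.mp (he.hilbertBasis hν).orthonormal, lp.coeFn_single]
  by_cases hij : j = i
  · subst hij; simp
  · simp [hij]

lemma nuclearlyDominated_iff (he : IsEigensystem hH ν μ e) (hν : IsPositiveFor hH ν) {β : ℝ}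
    (hβ : 0 < β) (hβ1 : β < 1) (hs : PowerSummable μ e β) :
    NuclearlyDominated H (PowerSpace he hβ hs) ↔ Summable fun i => μ i ^ (1 - β) := by
  classical
  constructor
  · rintro ⟨J, hJ, w, b, hb⟩
    -- Elements of an RKHS are determined by their values, so the inclusion is unique.
    have hJe : J = he.powerEmbedding hν hβ hβ1 hs := by
      ext h t
      rw [hJ, powerEmbedding_apply]
    subst hJe
    refine summable_of_sum_le (fun i => Real.rpow_nonneg (he.pos i).le _)
      (c := ∑' j, ‖he.powerEmbedding hν hβ hβ1 hs (b j)‖ ^ 2) fun s => ?_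
    -- The basis b given by the Hilbert-Schmidt property is arbitrary; Parseval for u_i in b
    -- recovers μ_i^{1-β} as the sum over j of the squared i-th coordinates of J b_j.
    have h1 : ∀ i, HasSum (fun j => (he.powerCoeff hν hβ1 (b j) i) ^ 2) (μ i ^ (1 - β)) :=
      fun i => by
        have h2 := (b.hasSum_inner_mul_inner (he.hilbertBasis hν i)
          (he.hilbertBasis hν i)).mul_left (μ i ^ (1 - β))
        rw [real_inner_self_eq_norm_sq, (he.hilbertBasis hν).orthonormal.1 i, one_pow,
          mul_one] at h2
        convert! h2 using 1
        ext1 j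
        rw [powerCoeff_apply, mul_pow, he.rpow_half_sq, real_inner_comm _ (b j), sq ⟪_, _⟫_ℝ]
    refine hasSum_le (fun j => ?_) (hasSum_sum fun i (_ : i ∈ s) => h1 i) hb.hasSum
    have h2 := lp.sum_rpow_le_norm_rpow (p := 2) (by norm_num) (he.powerCoeff hν hβ1 (b j)) s
    simp only [ENNReal.toReal_ofNat, Real.rpow_two, Real.norm_eq_abs, sq_abs] at h2
    exact h2
  · intro hsum
    refine ⟨he.powerEmbedding hν hβ hβ1 hs, he.powerEmbedding_apply hν hβ hβ1 hs,
      .of_hilbertBasis (he.hilbertBasis hν) _ (hsum.congr fun i => Eq.symm ?_)⟩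
    change ‖he.powerCoeff hν hβ1 (he.hilbertBasis hν i)‖ ^ 2 = _
    rw [powerCoeff_hilbertBasis, lp.norm_single (by norm_num), Real.norm_eq_abs, sq_abs,
      he.rpow_half_sq]

end IsEigensystem

end Dominance

/-! ### The Loève isometry and the version with paths in the power space -/

section Paths

variable {Ω T ι : Type*} [MeasurableSpace Ω] {P : Measure Ω} {X : T → Ω → ℝ}

lemma IsCenteredGaussianProcess.memLp (hX : IsCenteredGaussianProcess X P) (t : T) :
    MemLp (X t) 2 P :=
  (hX.gaussian.hasGaussianLaw_eval t).memLp_two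

lemma inner_kerFun_covRKHS (hX : IsCenteredGaussianProcess X P) (s t : T) :
    ⟪RKHS.kerFun (CovRKHS hX) s (1 : ℝ), RKHS.kerFun (CovRKHS hX) t (1 : ℝ)⟫_ℝ =
      ⟪(hX.memLp s).toLp (X s), (hX.memLp t).toLp (X t)⟫_ℝ := by
  rw [← RKHS.kernel_inner, kernel_covRKHS, L2.inner_def]
  have h1 : ⟪kernelMatrix (covFun X P) t s 1, (1 : ℝ)⟫_ℝ = covFun X P t s := by
    simp [kernelMatrix]
  rw [h1, covFun]
  refine integral_congr_ae ?_
  filter_upwards [(hX.memLp s).coeFn_toLp, (hX.memLp t).coeFn_toLp] with ω hs ht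
  rw [hs, ht]
  simp

/-- The Loève isometry `H_X → L²(P)`, `k_X(t, ·) ↦ X_t`, as a contraction. -/
lemma exists_loeve (hX : IsCenteredGaussianProcess X P) :
    ∃ Ψ : CovRKHS hX →L[ℝ] Lp ℝ 2 P, (∀ h, ‖Ψ h‖ ≤ ‖h‖) ∧
      ∀ t, Ψ (RKHS.kerFun (CovRKHS hX) t (1 : ℝ)) = (hX.memLp t).toLp (X t) := by
  let S := Finsupp.linearCombination ℝ fun t => RKHS.kerFun (CovRKHS hX) t (1 : ℝ)
  let R := Finsupp.linearCombination ℝ fun t => (hX.memLp t).toLp (X t)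
  have hnorm : ∀ c, ‖R c‖ ≤ 1 * ‖S c‖ := fun c => by
    rw [one_mul]
    exact (norm_linearCombination_eq (inner_kerFun_covRKHS hX) c).ge
  have hdense : DenseRange S := by
    have h1 := RKHS.kerFun_dense (CovRKHS hX)
    rw [← Submodule.dense_iff_topologicalClosure_eq_top] at h1
    refine h1.mono ?_
    rw [← LinearMap.coe_range, Finsupp.range_linearCombination]
    refine Submodule.span_le.mpr ?_
    rintro _ ⟨t, v, rfl⟩
    have h2 : RKHS.kerFun (CovRKHS hX) t v = v • RKHS.kerFun (CovRKHS hX) t (1 : ℝ) := by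
      rw [← map_smul, smul_eq_mul, mul_one]
    rw [h2]
    exact Submodule.smul_mem _ _ (Submodule.subset_span ⟨t, rfl⟩)
  refine ⟨R.extendOfNorm S, fun h => ?_, fun t => ?_⟩
  · simpa using LinearMap.norm_extendOfNorm_apply_le hdense 1 hnorm h
  · have h1 := LinearMap.extendOfNorm_eq hdense ⟨1, hnorm⟩ (Finsupp.single t 1)
    simpa [S, R] using h1

/-- Karhunen-Loève expansion of `X_t` along a Hilbert basis of `H_X`. -/
lemma exists_hasSum_smul_toLp (hX : IsCenteredGaussianProcess X P)
    (b : HilbertBasis ι ℝ (CovRKHS hX)) :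
    ∃ ξ : ι → Lp ℝ 2 P, (∀ i, ‖ξ i‖ ≤ 1) ∧
      ∀ t, HasSum (fun i => b i t • ξ i) ((hX.memLp t).toLp (X t)) := by
  obtain ⟨Ψ, hΨ, hΨX⟩ := exists_loeve hX
  refine ⟨fun i => Ψ (b i), fun i => (hΨ _).trans_eq (b.orthonormal.1 i), fun t => ?_⟩
  have h1 := (b.hasSum_repr (RKHS.kerFun (CovRKHS hX) t (1 : ℝ))).mapL Ψ
  rw [hΨX] at h1
  convert! h1 using 1
  ext1 i
  rw [map_smul, HilbertBasis.repr_apply_apply, real_inner_comm, inner_kerFun_one]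

/-- A weighted `ℓ²` sum of square integrable functions of norm at most one is a.s. finite. -/
lemma ae_summable_mul_sq [Countable ι] {c : ι → ℝ} (hc0 : ∀ i, 0 ≤ c i) (hc : Summable c)
    {ξ : ι → Lp ℝ 2 P} (hξ : ∀ i, ‖ξ i‖ ≤ 1) :
    ∀ᵐ ω ∂P, ∑' i, ENNReal.ofReal (c i * ξ i ω ^ 2) < ⊤ := by
  have hm : ∀ i, Measurable fun ω => ENNReal.ofReal (c i * ξ i ω ^ 2) := fun i =>
    (((Lp.stronglyMeasurable (ξ i)).measurable.pow_const 2).const_mul _).ennreal_ofReal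
  refine ae_lt_top (Measurable.tsum hm) ?_
  rw [lintegral_tsum fun i => (hm i).aemeasurable]
  refine ne_top_of_le_ne_top hc.tsum_ofReal_ne_top (ENNReal.tsum_le_tsum fun i => ?_)
  have hint : Integrable (fun ω => c i * ξ i ω ^ 2) P :=
    (Lp.memLp (ξ i)).integrable_sq.const_mul _
  rw [← ofReal_integral_eq_lintegral_ofReal hint
    (ae_of_all _ fun ω => mul_nonneg (hc0 i) (sq_nonneg _)), integral_const_mul]
  refine ENNReal.ofReal_le_ofReal (mul_le_of_le_one_right (hc0 i) ?_)
  have h1 : ∫ ω, ξ i ω ^ 2 ∂P = ‖ξ i‖ ^ 2 := by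
    rw [← real_inner_self_eq_norm_sq, L2.inner_def]
    simp [sq]
  rw [h1]
  exact pow_le_one₀ (norm_nonneg _) (hξ i)

/-- Along a summable series in `L²(P)`, any pointwise sum is a.e. equal to the sum in `L²(P)`. -/
lemma ae_eq_of_hasSum_Lp [Countable ι] {c : ι → ℝ} {ξ : ι → Lp ℝ 2 P} {Z : Lp ℝ 2 P}
    (hZ : HasSum (fun i => c i • ξ i) Z) {Y : Ω → ℝ}
    (hY : ∀ᵐ ω ∂P, HasSum (fun i => c i * ξ i ω) (Y ω)) : Y =ᵐ[P] Z := by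
  -- Countability of ι lets a sequence of finite partial sums converge a.e. to Z and lets the
  -- exceptional null sets of all partial sums be united.
  obtain ⟨ns, hns, hae⟩ := (tendstoInMeasure_of_tendsto_Lp hZ).exists_seq_tendsto_ae'
  have h1 : ∀ s : Finset ι, ((∑ i ∈ s, c i • ξ i : Lp ℝ 2 P) : Ω → ℝ)
      =ᵐ[P] fun ω => ∑ i ∈ s, c i * ξ i ω := fun s => by
    have h2 : ∀ i, (c i • ξ i : Lp ℝ 2 P) =ᵐ[P] fun ω => c i * ξ i ω := fun i =>
      Lp.coeFn_smul (c i) (ξ i)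
    filter_upwards [Lp.coeFn_finsetSum s fun i => c i • ξ i, ae_all_iff.mpr h2] with ω h3 h4
    rw [h3]
    simp [h4]
  filter_upwards [hY, hae, ae_all_iff.mpr h1] with ω hY hω h3
  refine tendsto_nhds_unique (hY.comp hns) (hω.congr fun n => ?_)
  rw [h3]
  rfl

variable [MeasurableSpace T] {ν : Measure T} [IsFiniteMeasure ν]

/-- If `∑ μ_i^{1-β} < ∞`, then `X` has a version with paths in `H_X^β`. -/
lemma IsEigensystem.exists_version {hX : IsCenteredGaussianProcess X P}
    {hH : BoundedMeasurable (T := T) (CovRKHS hX)} {μ : ι → ℝ} {e : ι → CovRKHS hX}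
    (he : IsEigensystem hH ν μ e) (hν : IsPositiveFor hH ν) {β : ℝ} (hβ : 0 < β)
    (hs : PowerSummable μ e β) (hsum : Summable fun i => μ i ^ (1 - β)) :
    ∃ Y : T → Ω → ℝ, IsVersion Y X P ∧
      ∀ ω, ∃ f : PowerSpace he hβ hs, ∀ t, f t = Y t ω := by
  classical
  have hc : Countable ι := by
    rw [← Set.countable_univ_iff]
    exact hsum.countable_support.mono fun i _ => (Real.rpow_pos_of_pos (he.pos i) _).ne'
  obtain ⟨ξ, hξ, hξX⟩ := exists_hasSum_smul_toLp hX (he.hilbertBasis hν)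
  have hm : ∀ i, Measurable (ξ i) := fun i => (Lp.stronglyMeasurable (ξ i)).measurable
  let A : Set Ω := {ω | ∑' i, ENNReal.ofReal (μ i ^ (1 - β) * ξ i ω ^ 2) < ⊤}
  have hAm : MeasurableSet A :=
    measurableSet_lt (Measurable.tsum fun i =>
      (((hm i).pow_const 2).const_mul _).ennreal_ofReal) measurable_const
  have hA : ∀ᵐ ω ∂P, ω ∈ A :=
    ae_summable_mul_sq (fun i => Real.rpow_nonneg (he.pos i).le _) hsum hξ
  -- Setting the coefficients to zero off the measurable set A puts every path in H^β while keeping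
  -- Y_t measurable; since A has full measure, Y_t is unchanged a.s.
  let x : ι → Ω → ℝ := fun i => A.indicator fun ω => μ i ^ ((1 - β) / 2) * ξ i ω
  have hx : ∀ ω, Memℓp (fun i => x i ω) 2 := fun ω => by
    by_cases hω : ω ∈ A
    · refine memℓp_gen ((ENNReal.summable_toReal hω.ne).congr fun i => ?_)
      rw [ENNReal.toReal_ofReal (mul_nonneg (Real.rpow_nonneg (he.pos i).le _) (sq_nonneg _))]
      simp only [x, Set.indicator_of_mem hω, ENNReal.toReal_ofNat, Real.rpow_two,
        Real.norm_eq_abs, sq_abs, mul_pow, he.rpow_half_sq]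
    · have h1 : (fun i => x i ω) = 0 := by
        ext i; simp [x, hω]
      rw [h1]
      exact zero_memℓp
  let a : Ω → lp (fun _ : ι => ℝ) 2 := fun ω => ⟨fun i => x i ω, hx ω⟩
  let Y : T → Ω → ℝ := fun t ω => ∑' i, x i ω * (μ i ^ (β / 2) * e i t)
  have hY : ∀ t ω, HasSum (fun i => x i ω * (μ i ^ (β / 2) * e i t)) (Y t ω) := fun t ω =>
    hasSum_power he hs (a ω) t
  refine ⟨Y, fun t => ⟨?_, ?_⟩, fun ω => ⟨a ω, fun t => rfl⟩⟩
  · refine measurable_of_tendsto_metrizable' (atTop : Filter (Finset ι))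
      (f := fun s ω => ∑ i ∈ s, x i ω * (μ i ^ (β / 2) * e i t)) (fun s => ?_)
      (tendsto_pi_nhds.mpr fun ω => hY t ω)
    exact Finset.measurable_fun_sum _ fun i _ =>
      (((hm i).const_mul _).indicator hAm).mul_const _
  · have h1 : Y t =ᵐ[P] (hX.memLp t).toLp (X t) := by
      refine ae_eq_of_hasSum_Lp (hξX t) ?_
      filter_upwards [hA] with ω hω
      convert! hY t ω using 1
      ext1 i
      rw [he.hilbertBasis_apply hν, RKHS.coe_smul, Pi.smul_apply, smul_eq_mul,
        ← he.rpow_mul_rpow_eq_sqrt β i]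
      simp only [x, Set.indicator_of_mem hω]
      ring
    exact h1.trans (hX.memLp t).coeFn_toLp

end Paths

end GaussianPaths

end

theorem mainTheorem3 {Ω T ι : Type*} [MeasurableSpace Ω] [MeasurableSpace T]
    (P : Measure Ω) [IsProbabilityMeasure P] (ν : Measure T) [IsFiniteMeasure ν]
    (X : T → Ω → ℝ) (hX : GaussianPaths.IsCenteredGaussianProcess X P)
    (hH : GaussianPaths.BoundedMeasurable (T := T) (GaussianPaths.CovRKHS hX))
    (μ : ι → ℝ) (e : ι → GaussianPaths.CovRKHS hX)
    (he : GaussianPaths.IsEigensystem hH ν μ e) :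
    (GaussianPaths.IsNuclear (GaussianPaths.toL2 hH ν) ↔ Summable fun i => √(μ i)) ∧
    (GaussianPaths.IsPositiveFor hH ν →
      ∀ (β : ℝ) (hβ : 0 < β), β < 1 → ∀ hs : GaussianPaths.PowerSummable μ e β,
        (GaussianPaths.NuclearlyDominated (GaussianPaths.CovRKHS hX)
            (GaussianPaths.PowerSpace he hβ hs) ↔
          Summable fun i => μ i ^ (1 - β)) ∧
        (GaussianPaths.NuclearlyDominated (GaussianPaths.CovRKHS hX)
            (GaussianPaths.PowerSpace he hβ hs) →
          ∃ Y : T → Ω → ℝ, GaussianPaths.IsVersion Y X P ∧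
            ∀ᵐ ω ∂P, ∃ f : GaussianPaths.PowerSpace he hβ hs, ∀ t, f t = Y t ω)) := by
  refine ⟨⟨he.summable_of_isNuclear, he.isNuclear_of_summable⟩, fun hν β hβ hβ1 hs => ?_⟩
  have hiff := he.nuclearlyDominated_iff hν hβ hβ1 hs
  refine ⟨hiff, fun hdom => ?_⟩
  obtain ⟨Y, hYX, hY⟩ := he.exists_version hν hβ hs (hiff.mp hdom)
  exact ⟨Y, hYX, ae_of_all P hY⟩
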